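/- Let $(W,S)$ be a Coxeter system ($S$ possibly infinite), and for $s,t\in S$ let $n(s,t)\in\{1,2,\dots\}\cup\{\infty\}$ be the order of $st$. Let $H$ be the Hecke algebra of $(W,S)$ over $\mathbb{Q}(u)$, that is, the associative unital algebra with generators $T_s$ ($s\in S$) and relations $(T_s-u^2)(T_s+1)=0$ for $s\in S$ and $$T_sT_tT_s\cdots=T_tT_sT_t\cdots\quad(n(s,t)\text{ factors on each side})$$ for $s\neq t$ with $n(s,t)<\infty$. An $S$-labeled digraph $\Gamma$ is a directed multigraph without loops in which every edge is either solid or dashed and is labeled by an element of $S$, such that for each $s\in S$ every vertex occurs in exactly one edge labeled $s$. Let $M(\Gamma)$ be the $\mathbb{Q}(u)$-vector space with basis the set of vertices of $\Gamma$, and for $s\in S$ let $\tau_s$ be the linear operator on $M(\Gamma)$ given on a vertex $\alpha$, where $\beta$ is the other end of the edge labeled $s$ that contains $\alpha$, by $$\tau_s(\alpha)=\begin{cases}\beta&\text{if the edge is solid, from }\alpha\text{ to }\beta,\\(u^2-1)\alpha+u^2\beta&\text{if the edge is solid, from }\beta\text{ to }\alpha,\\u\alpha+(u+1)\beta&\text{if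 the edge is dashed, from }\alpha\text{ to }\beta,\\(u^2-u-1)\alpha+(u^2-u)\beta&\text{if the edge is dashed, from }\beta\text{ to }\alpha.\end{cases}$$ $\Gamma$ is a $W$-digraph if $T_s\mapsto\tau_s$ extends to a homomorphism of $\mathbb{Q}(u)$-algebras from $H$ to the algebra of linear operators on $M(\Gamma)$. A source (sink) of $\Gamma$ is a vertex that no edge enters (leaves); $\Gamma$ is acyclic if it has no nonempty directed circuit; $\Gamma$ is connected if it is nonempty and its underlying undirected graph is connected. **Theorem.** If $n(s,t)<\infty$ for all $s,t\in S$ and $\Gamma$ is a connected $W$-digraph, then the following hold. (i) $\Gamma$ has at most one source and at most one sink. (ii) If $\Gamma$ has either a source or a sink, then $\Gamma$ is acyclic. (iii) If $W$ is finite, then $\Gamma$ has both a source and a sink, and so is acyclic. -/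

import Mathlib

noncomputable section

/-- The field `ℚ(u)` of rational functions in one indeterminate over `ℚ`. -/
abbrev Qu : Type := RatFunc ℚ

/-- The indeterminate `u` of `ℚ(u)`. -/
def uu : Qu := RatFunc.X

/-- The alternating product `a b a ⋯` with `n` factors. -/
def altProd {A : Type*} [Monoid A] : A → A → ℕ → A
  | _, _, 0 => 1
  | a, b, n + 1 => a * altProd b a n

/-- The defining relations of the Hecke algebra of a Coxeter matrix `M` (an entry `0` of `M`
stands for `∞`, as in Mathlib): the quadratic relations `(T_s - u²)(T_s + 1) = 0` and, for
`s ≠ t` with `n = M s t` finite, the braid relations `T_s T_t ⋯ = T_t T_s ⋯` (`n` factors). -/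
inductive HeckeRel {S : Type*} (M : CoxeterMatrix S) :
    FreeAlgebra Qu S → FreeAlgebra Qu S → Prop
  | quadratic (s : S) :
      HeckeRel M
        ((FreeAlgebra.ι Qu s - algebraMap Qu (FreeAlgebra Qu S) (uu ^ 2)) *
          (FreeAlgebra.ι Qu s + 1)) 0
  | braid (s t : S) (hst : s ≠ t) (hfin : M s t ≠ 0) :
      HeckeRel M
        (altProd (FreeAlgebra.ι Qu s) (FreeAlgebra.ι Qu t) (M s t))
        (altProd (FreeAlgebra.ι Qu t) (FreeAlgebra.ι Qu s) (M s t))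

/-- The Hecke algebra over `ℚ(u)` of the Coxeter system with Coxeter matrix `M`: the associative
unital algebra generated by the `T_s`, `s ∈ S`, subject to the quadratic and braid relations. -/
abbrev HeckeAlgebra {S : Type*} (M : CoxeterMatrix S) : Type _ := RingQuot (HeckeRel M)

/-- The generator `T_s` of the Hecke algebra. -/
def HeckeAlgebra.T {S : Type*} (M : CoxeterMatrix S) (s : S) : HeckeAlgebra M :=
  RingQuot.mkAlgHom Qu (HeckeRel M) (FreeAlgebra.ι Qu s)

/-- Every edge is either solid or dashed. -/
inductive EdgeStyle
  | solid
  | dashed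

/-- A solid or dashed directed edge from `src` to `tgt`, labeled by an element of `S`. -/
structure LabeledEdge (S V : Type*) where
  src : V
  tgt : V
  label : S
  style : EdgeStyle

/-- An `S`-labeled digraph with vertex set `V`: a set of solid or dashed directed labeled edges,
without loops, such that for every `s ∈ S` every vertex occurs in exactly one edge labeled `s`.
(The last condition forces edges with the same endpoints to have different labels, so that a
set of edges loses nothing compared to a family of edges.) -/
structure LabeledDigraph (S V : Type*) where
  edges : Set (LabeledEdge S V)
  loopless : ∀ e ∈ edges, e.src ≠ e.tgt
  existsUnique_edge : ∀ (s : S) (α : V),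
    ∃! e : LabeledEdge S V, e ∈ edges ∧ e.label = s ∧ (e.src = α ∨ e.tgt = α)

namespace LabeledDigraph

variable {S V : Type*} (Γ : LabeledDigraph S V)

/-- The unique edge labeled `s` in which the vertex `α` occurs. -/
def edgeAt (s : S) (α : V) : LabeledEdge S V := (Γ.existsUnique_edge s α).choose

open Classical in
/-- The vector `τ_s(α)` in the vector space over `ℚ(u)` with basis the vertices of `Γ`. -/
def tauVec (s : S) (α : V) : V →₀ Qu :=
  let e := Γ.edgeAt s α
  if e.src = α then
    match e.style with
    | EdgeStyle.solid => Finsupp.single e.tgt 1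
    | EdgeStyle.dashed => Finsupp.single α uu + Finsupp.single e.tgt (uu + 1)
  else
    match e.style with
    | EdgeStyle.solid => Finsupp.single α (uu ^ 2 - 1) + Finsupp.single e.src (uu ^ 2)
    | EdgeStyle.dashed =>
        Finsupp.single α (uu ^ 2 - uu - 1) + Finsupp.single e.src (uu ^ 2 - uu)

/-- The linear operator `τ_s` on the vector space over `ℚ(u)` with basis the vertices. -/
def tau (s : S) : Module.End Qu (V →₀ Qu) :=
  Finsupp.linearCombination Qu (Γ.tauVec s)

/-- `Γ` is a `W`-digraph, where `W` is the Coxeter group with Coxeter matrix `M`: the mapping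
`T_s ↦ τ_s` extends to a representation of the Hecke algebra. -/
def IsWDigraph (M : CoxeterMatrix S) : Prop :=
  ∃ ρ : HeckeAlgebra M →ₐ[Qu] Module.End Qu (V →₀ Qu), ∀ s : S, ρ (HeckeAlgebra.T M s) = Γ.tau s

/-- There is a directed edge from `α` to `β` (of any label and style). -/
def DirAdj (α β : V) : Prop := ∃ e ∈ Γ.edges, e.src = α ∧ e.tgt = β

/-- A source: a vertex that no directed edge enters. -/
def IsSource (α : V) : Prop := ∀ β : V, ¬ Γ.DirAdj β α

/-- A sink: a vertex that no directed edge leaves. -/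
def IsSink (α : V) : Prop := ∀ β : V, ¬ Γ.DirAdj α β

/-- `Γ` is acyclic: there is no nonempty directed circuit, that is, no nonempty directed path from
a vertex to itself. -/
def IsAcyclic : Prop := ∀ α : V, ¬ Relation.TransGen Γ.DirAdj α α

/-- The undirected graph obtained from `Γ` by forgetting labels, styles and directions
(multiplicities of edges, which do not matter for connectedness, are forgotten as well). -/
def undir : SimpleGraph V where
  Adj α β := Γ.DirAdj α β ∨ Γ.DirAdj β α
  symm := ⟨fun _ _ h => h.symm⟩
  loopless := ⟨by
    rintro α (⟨e, he, h₁, h₂⟩ | ⟨e, he, h₁, h₂⟩) <;> exact Γ.loopless e he (h₁.trans h₂.symm)⟩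

/-- `Γ` is connected (in particular it has a vertex). -/
def IsConnected : Prop := Γ.undir.Connected

end LabeledDigraph

end

/-!
The matrix entries of the operators `τ_s` are polynomials in `u` with integer coefficients, so the
braid relations hold for all integers `u`. Everything below takes place for `u = 3`, where all entries are nonnegative, off-diagonal entries are nonzero,
`τ_s² ≡ 1` modulo `2`, and reduction modulo `3` amounts to `u = 0`.

*Rank two.* For `u = 0` the operator `τ_s` moves a vertex, up to sign, to the upper end of its edge
labeled `s` (`EdgeSystem.signedMod_op`), and the transpose of `-u² τ_s⁻¹` moves it to the lower end
(`EdgeSystem.signedMod_coOpT`). Hence these moves satisfy the braid relations. Moreover, the sum of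
the `T_w` over the dihedral group generated by `s` and `t` provides a functional that is multiplied
by `u²` under `τ_s` and `τ_t` and does not vanish at a given vertex
(`EdgeSystem.exists_isWeight`). Its values are multiplied by `u² = 9` along solid edges and by
`(u² - u) / (u + 1) = 3 / 2` along dashed ones, so that their `3`-adic valuations are heights which
rise by `2` and `1` (`EdgeSystem.IsWeight.isHeight`). Together this gives the diamond property: two
edges with a common end `α` can be completed to two paths of equal weights from a common start to
`α` (`EdgeSystem.Braided.diamond`), and likewise for the reversed digraph.

*Sources and sinks.* In a connected weighted digraph with the diamond property, every vertex is
reachable from a source, and the weight of the path drops when one passes to a predecessor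
(`WPath.of_edge`). Thus a source is unique and there are no circuits.

*Finite groups.* Modulo `2` the operators define a homomorphism from `W`, so the ring they generate
is spanned, modulo any power of `2`, by `|W|` elements. Therefore a walk cannot meet more than `|W|`
distinct vertices (`EdgeSystem.Braided.not_injective_walk`). This applies as well to the covering of the
digraph with vertex set `V × ℤ` whose second coordinate is a height: it satisfies the braid
relations because heights exist on the rank two components (`EdgeSystem.Braided.cover`). Without a
source there would be an infinite descending walk, and its lift to the covering would be injective.
-/

noncomputable section

/-! ### Alternating products -/

lemma map_altProd {A B F : Type*} [Monoid A] [Monoid B] [FunLike F A B] [MonoidHomClass F A B]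
    (f : F) : ∀ (n : ℕ) (a b : A), f (altProd a b n) = altProd (f a) (f b) n
  | 0, _, _ => map_one f
  | n + 1, a, b => by simp only [altProd, map_mul, map_altProd f n b a]

/-- Maps intertwining two pairs of operators intertwine their alternating products. -/
lemma altProd_intertwine {R R' X Y : Type*} [Semiring R] [AddCommMonoid X] [Module R X]
    [Semiring R'] [AddCommMonoid Y] [Module R' Y] (Φ : X → Y) (n : ℕ)
    {a b : Module.End R X} {a' b' : Module.End R' Y} (ha : ∀ x, Φ (a x) = a' (Φ x))
    (hb : ∀ x, Φ (b x) = b' (Φ x)) (x : X) : Φ (altProd a b n x) = altProd a' b' n (Φ x) := by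
  induction n generalizing a b a' b' with
  | zero => rfl
  | succ n ih =>
    change Φ (a (altProd b a n x)) = a' (altProd b' a' n (Φ x))
    rw [ha, ih hb ha]

/-- An alternating product can be extended on the right; the last factor depends on parity. -/
lemma altProd_succ_right {A : Type*} [Monoid A] :
    ∀ (n : ℕ) (a b : A), altProd a b (n + 1) = altProd a b n * (if Even n then a else b)
  | 0, a, b => by simp [altProd]
  | n + 1, a, b => by
      rw [altProd, altProd_succ_right n b a, altProd, mul_assoc]
      by_cases h : Even n <;> simp [h, Nat.even_add_one]

/-! ### Edge systems -/

/-- The combinatorial content of an `S`-labeled digraph: `nb s x` is the other end of the edge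
labeled `s` at `x`, `out s x` says whether this edge leaves `x`, and `dashed s x` whether it is
dashed. -/
structure EdgeSystem (S V : Type*) where
  nb : S → V → V
  out : S → V → Bool
  dashed : S → V → Bool
  nb_nb : ∀ s x, nb s (nb s x) = x
  out_nb : ∀ s x, out s (nb s x) = !out s x
  dashed_nb : ∀ s x, dashed s (nb s x) = dashed s x

/-- The coefficient of `x` in `τ_s(x)` for `u = q`; the arguments are `out s x`, `dashed s x`. -/
def diagCoeff {R : Type*} [CommRing R] (q : R) : Bool → Bool → R
  | true, false => 0
  | true, true => q
  | false, false => q ^ 2 - 1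
  | false, true => q ^ 2 - q - 1

/-- The coefficient of the other end of the edge in `τ_s(x)` for `u = q`; the arguments are
`out s x`, `dashed s x`. -/
def offCoeff {R : Type*} [CommRing R] (q : R) : Bool → Bool → R
  | true, false => 1
  | true, true => q + 1
  | false, false => q ^ 2
  | false, true => q ^ 2 - q

lemma map_diagCoeff {R R' : Type*} [CommRing R] [CommRing R'] (φ : R →+* R') (q : R)
    (o d : Bool) : φ (diagCoeff q o d) = diagCoeff (φ q) o d := by
  cases o <;> cases d <;> simp [diagCoeff]

lemma map_offCoeff {R R' : Type*} [CommRing R] [CommRing R'] (φ : R →+* R') (q : R)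
    (o d : Bool) : φ (offCoeff q o d) = offCoeff (φ q) o d := by
  cases o <;> cases d <;> simp [offCoeff]

namespace EdgeSystem

open Finsupp

variable {S V : Type*} (G : EdgeSystem S V)

/-- The operator `τ_s` for the value `q` of `u` in an arbitrary commutative ring. -/
def op {R : Type*} [CommRing R] (q : R) (s : S) : Module.End R (V →₀ R) :=
  Finsupp.linearCombination R fun x =>
    single x (diagCoeff q (G.out s x) (G.dashed s x)) +
      single (G.nb s x) (offCoeff q (G.out s x) (G.dashed s x))

lemma op_single {R : Type*} [CommRing R] (q : R) (s : S) (x : V) (c : R) :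
    G.op q s (single x c) = single x (c * diagCoeff q (G.out s x) (G.dashed s x)) +
      single (G.nb s x) (c * offCoeff q (G.out s x) (G.dashed s x)) := by
  simp [op, linearCombination_single]

lemma mapRange_op {R R' : Type*} [CommRing R] [CommRing R'] (φ : R →+* R') (q : R) (s : S)
    (f : V →₀ R) : mapRange.addMonoidHom φ.toAddMonoidHom (G.op q s f) =
      G.op (φ q) s (mapRange.addMonoidHom φ.toAddMonoidHom f) := by
  induction f using Finsupp.induction_linear with
  | zero => simp
  | add f g hf hg => simp only [map_add, hf, hg]
  | single x c =>
    simp only [op_single, map_add, mapRange.addMonoidHom_apply, RingHom.toAddMonoidHom_eq_coe,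
      AddMonoidHom.coe_coe, mapRange_single, map_mul, map_diagCoeff, map_offCoeff]

/-- The braid relations between the operators `τ_s` for `u = q`. -/
def Braided {R : Type*} [CommRing R] (M : CoxeterMatrix S) (q : R) : Prop :=
  ∀ s t, s ≠ t → altProd (G.op q s) (G.op q t) (M s t) = altProd (G.op q t) (G.op q s) (M s t)

variable {G}

lemma Braided.of_injective {R R' : Type*} [CommRing R] [CommRing R'] {φ : R →+* R'} {q : R}
    {M : CoxeterMatrix S} (hφ : Function.Injective φ) (h : G.Braided M (φ q)) :
    G.Braided M q := by
  intro s t hst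
  refine LinearMap.ext fun f => ?_
  have hinj : Function.Injective (mapRange.addMonoidHom (ι := V) φ.toAddMonoidHom) :=
    Finsupp.mapRange_injective _ (map_zero φ) hφ
  apply hinj
  rw [altProd_intertwine _ _ (G.mapRange_op φ q s) (G.mapRange_op φ q t),
    altProd_intertwine _ _ (G.mapRange_op φ q t) (G.mapRange_op φ q s), h s t hst]

lemma Braided.of_surjective {R R' : Type*} [CommRing R] [CommRing R'] {φ : R →+* R'} {q : R}
    {M : CoxeterMatrix S} (hφ : Function.Surjective φ) (h : G.Braided M q) :
    G.Braided M (φ q) := by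
  intro s t hst
  refine LinearMap.ext fun f => ?_
  have hsurj : Function.Surjective (mapRange.addMonoidHom (ι := V) φ.toAddMonoidHom) :=
    Finsupp.mapRange_surjective _ (map_zero φ) hφ
  obtain ⟨f, rfl⟩ := hsurj f
  rw [← altProd_intertwine _ _ (G.mapRange_op φ q s) (G.mapRange_op φ q t),
    ← altProd_intertwine _ _ (G.mapRange_op φ q t) (G.mapRange_op φ q s), h s t hst]

variable (G) in
/-- The quadratic relation `(τ_s - u²)(τ_s + 1) = 0`, for `u = q`. -/
lemma op_mul_op {R : Type*} [CommRing R] (q : R) (s : S) :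
    G.op q s * G.op q s = (q ^ 2 - 1) • G.op q s + (q ^ 2) • 1 := by
  refine Finsupp.lhom_ext fun x c => ?_
  simp only [Module.End.mul_apply, op_single, map_add, LinearMap.add_apply, LinearMap.smul_apply,
    Module.End.one_apply, smul_add, smul_single, G.out_nb, G.dashed_nb, G.nb_nb]
  have key : ∀ a b c d e f g : R, a + d = e + g → b + c = f →
      single x a + single (G.nb s x) b + (single (G.nb s x) c + single x d) =
        single x e + single (G.nb s x) f + single x g := by
    intro a b c d e f g h h'
    have h2 : single x a + single x d = single x e + single x g := by
      rw [← single_add, h, single_add]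
    rw [← h', single_add, add_right_comm _ _ (single x g), ← h2]; abel
  apply key <;> rcases G.out s x <;> rcases G.dashed s x <;>
    simp [diagCoeff, offCoeff] <;> ring

end EdgeSystem

/-! ### The edge system of a labeled digraph -/

namespace LabeledDigraph

variable {S V : Type*} (Γ : LabeledDigraph S V)

lemma edgeAt_spec (s : S) (α : V) : Γ.edgeAt s α ∈ Γ.edges ∧ (Γ.edgeAt s α).label = s ∧
    ((Γ.edgeAt s α).src = α ∨ (Γ.edgeAt s α).tgt = α) :=
  (Γ.existsUnique_edge s α).choose_spec.1

lemma edgeAt_eq {e : LabeledEdge S V} (he : e ∈ Γ.edges) {α : V} (h : e.src = α ∨ e.tgt = α) :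
    Γ.edgeAt e.label α = e :=
  ((Γ.existsUnique_edge e.label α).choose_spec.2 e ⟨he, rfl, h⟩).symm

open Classical in
/-- The other end of the edge labeled `s` at `α`. -/
def otherEnd (s : S) (α : V) : V :=
  if (Γ.edgeAt s α).src = α then (Γ.edgeAt s α).tgt else (Γ.edgeAt s α).src

lemma edgeAt_otherEnd (s : S) (α : V) : Γ.edgeAt s (Γ.otherEnd s α) = Γ.edgeAt s α := by
  obtain ⟨h1, h2, h3⟩ := Γ.edgeAt_spec s α
  have := Γ.edgeAt_eq h1 (α := Γ.otherEnd s α) (by unfold otherEnd; split_ifs <;> simp)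
  rwa [h2] at this

lemma tgt_edgeAt_ne {s : S} {α : V} (h : (Γ.edgeAt s α).src = α) : (Γ.edgeAt s α).tgt ≠ α :=
  fun h' => Γ.loopless _ (Γ.edgeAt_spec s α).1 (h.trans h'.symm)

lemma tgt_edgeAt {s : S} {α : V} (h : (Γ.edgeAt s α).src ≠ α) : (Γ.edgeAt s α).tgt = α :=
  (Γ.edgeAt_spec s α).2.2.resolve_left h

open Classical in
/-- The edge system of a labeled digraph. -/
def edgeSystem : EdgeSystem S V where
  nb := Γ.otherEnd
  out s α := decide ((Γ.edgeAt s α).src = α)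
  dashed s α := match (Γ.edgeAt s α).style with
    | EdgeStyle.solid => false
    | EdgeStyle.dashed => true
  nb_nb s α := by
    by_cases h : (Γ.edgeAt s α).src = α
    · have h' := Γ.tgt_edgeAt_ne h
      rw [otherEnd, edgeAt_otherEnd, otherEnd, if_pos h, if_neg (by rw [h]; exact h'.symm), h]
    · rw [otherEnd, edgeAt_otherEnd, otherEnd, if_neg h, if_pos rfl, Γ.tgt_edgeAt h]
  out_nb s α := by
    rw [edgeAt_otherEnd, otherEnd]
    by_cases h : (Γ.edgeAt s α).src = α
    · have h' := Γ.tgt_edgeAt_ne h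
      rw [if_pos h, decide_eq_true h, h]; simpa using h'.symm
    · rw [if_neg h, decide_eq_false h]; simp
  dashed_nb s α := by rw [edgeAt_otherEnd]

lemma tau_eq_op (s : S) : Γ.tau s = Γ.edgeSystem.op uu s := by
  unfold tau EdgeSystem.op
  congr 1
  funext α
  by_cases h : (Γ.edgeAt s α).src = α <;> rcases hs : (Γ.edgeAt s α).style <;>
    simp [tauVec, edgeSystem, otherEnd, h, hs, diagCoeff, offCoeff]

lemma dirAdj_iff {α β : V} :
    Γ.DirAdj α β ↔ ∃ s, Γ.edgeSystem.out s α = true ∧ Γ.edgeSystem.nb s α = β := by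
  constructor
  · rintro ⟨e, he, h1, h2⟩
    have := Γ.edgeAt_eq he (Or.inl h1)
    exact ⟨e.label, by simp [edgeSystem, this, h1], by simp [edgeSystem, otherEnd, this, h1, h2]⟩
  · rintro ⟨s, h1, h2⟩
    have h : (Γ.edgeAt s α).src = α := by simpa [edgeSystem] using h1
    exact ⟨_, (Γ.edgeAt_spec s α).1, h, by simpa [edgeSystem, otherEnd, h] using h2⟩

variable {Γ}

/-- The operators of a `W`-digraph have polynomial entries, so their braid relations hold for
every integral value of `u`, in particular for `u = 3`. -/
lemma IsWDigraph.braided {M : CoxeterMatrix S} (hM : ∀ s t, M s t ≠ 0) (h : Γ.IsWDigraph M) :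
    Γ.edgeSystem.Braided M (3 : ℤ) := by
  have hQ : Γ.edgeSystem.Braided M uu := by
    obtain ⟨ρ, hρ⟩ := h
    intro s t hst
    have := congrArg ρ (RingQuot.mkAlgHom_rel Qu (HeckeRel.braid s t hst (hM s t)))
    rw [map_altProd, map_altProd, map_altProd, map_altProd] at this
    rw [← tau_eq_op, ← tau_eq_op, ← hρ, ← hρ]
    exact this
  have hinj : Function.Injective
      ((algebraMap (Polynomial ℚ) Qu).comp (Polynomial.mapRingHom (Int.castRingHom ℚ))) := by
    rw [RingHom.coe_comp]
    exact (RatFunc.algebraMap_injective ℚ).comp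
      (Polynomial.map_injective _ (RingHom.injective_int _))
  have hX : Γ.edgeSystem.Braided M (Polynomial.X : Polynomial ℤ) := by
    refine EdgeSystem.Braided.of_injective hinj ?_
    simpa [RatFunc.algebraMap_X, uu] using hQ
  have := EdgeSystem.Braided.of_surjective (φ := Polynomial.evalRingHom (3 : ℤ))
    (fun c => ⟨Polynomial.C c, by simp⟩) hX
  simpa using this

end LabeledDigraph

/-! ### Alternating products read from the right -/

/-- The alternating product `⋯ a b a` with `n` factors, ending in `a`. -/
def altProdRev {A : Type*} [Monoid A] : A → A → ℕ → A
  | _, _, 0 => 1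
  | a, b, n + 1 => altProdRev b a n * a

lemma altProdRev_eq {A : Type*} [Monoid A] : ∀ (n : ℕ) (a b : A),
    altProdRev a b n = if Even n then altProd b a n else altProd a b n
  | 0, a, b => by simp [altProdRev, altProd]
  | n + 1, a, b => by
      rw [altProdRev, altProdRev_eq n b a, altProd_succ_right, altProd_succ_right]
      by_cases h : Even n <;> simp [h, Nat.even_add_one]

lemma altProdRev_comm_iff {A : Type*} [Monoid A] {n : ℕ} {a b : A} :
    altProdRev a b n = altProdRev b a n ↔ altProd a b n = altProd b a n := by
  rw [altProdRev_eq, altProdRev_eq]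
  split_ifs
  · exact eq_comm
  · rfl

lemma altProd_mul_altProdRev {A : Type*} [Ring A] {k : ℤ} :
    ∀ (n : ℕ) {a b a' b' : A}, a * a' = k → b * b' = k →
      altProd a b n * altProdRev a' b' n = ((k ^ n : ℤ) : A)
  | 0, _, _, _, _, _, _ => by simp [altProd, altProdRev]
  | n + 1, a, b, a', b', ha, hb => by
      rw [altProd, altProdRev, mul_assoc a, ← mul_assoc (altProd b a n),
        altProd_mul_altProdRev n hb ha, Int.cast_comm, ← mul_assoc, ha, pow_succ]
      push_cast
      exact (Int.cast_commute k ((k : A) ^ n)).eq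

lemma altProdRev_mul_altProd {A : Type*} [Ring A] {k : ℤ} :
    ∀ (n : ℕ) {a b a' b' : A}, a' * a = k → b' * b = k →
      altProdRev a' b' n * altProd a b n = ((k ^ n : ℤ) : A)
  | 0, _, _, _, _, _, _ => by simp [altProd, altProdRev]
  | n + 1, a, b, a', b', ha, hb => by
      rw [altProd, altProdRev, mul_assoc _ a', ← mul_assoc a', ha, Int.cast_comm, ← mul_assoc,
        altProdRev_mul_altProd n hb ha, pow_succ]
      push_cast
      rfl

/-- If `a'` and `b'` are inverses of `a` and `b` up to a common integer factor, then they inherit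
the braid relation from `a` and `b`. -/
lemma altProd_comm_of_mul_eq {A : Type*} [Ring A] [IsAddTorsionFree A] {k : ℤ} (hk : k ≠ 0)
    {n : ℕ} {a b a' b' : A} (ha : a * a' = k) (ha' : a' * a = k) (hb : b * b' = k)
    (hb' : b' * b = k) (h : altProd a b n = altProd b a n) :
    altProd a' b' n = altProd b' a' n := by
  rw [← altProdRev_comm_iff]
  have h1 : altProdRev a' b' n * altProd b a n = ((k ^ n : ℤ) : A) :=
    h ▸ altProdRev_mul_altProd n ha' hb'
  have h2 := altProd_mul_altProdRev n hb ha
  have h3 : (k ^ n) • altProdRev b' a' n = (k ^ n) • altProdRev a' b' n := by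
    calc (k ^ n) • altProdRev b' a' n
        = altProdRev a' b' n * altProd b a n * altProdRev b' a' n := by rw [h1, zsmul_eq_mul]
      _ = (k ^ n) • altProdRev a' b' n := by rw [mul_assoc, h2, ← Int.cast_comm, zsmul_eq_mul]
  exact (zsmul_right_injective (pow_ne_zero n hk) h3).symm

/-- The sum of the alternating products of `a` and `b` with at most `n` factors, where `1` is counted
once and, of the two products with `n` factors, only the one ending in `a` occurs. If these two
products agree, this is the sum of the `T_w` over a dihedral group of order `2n`. -/
def altSum {A : Type*} [Ring A] (a b : A) (n : ℕ) : A :=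
  (∑ j ∈ Finset.range n, altProdRev b a j) * (1 + a)

lemma altSum_eq {A : Type*} [Ring A] (a b : A) (n : ℕ) : altSum a b n =
    ∑ j ∈ Finset.range n, altProdRev b a j + ∑ j ∈ Finset.range n, altProdRev a b (j + 1) := by
  rw [altSum, mul_add, mul_one, Finset.sum_mul]
  rfl

lemma altSum_comm {A : Type*} [Ring A] {a b : A} {n : ℕ} (h : altProd a b n = altProd b a n) :
    altSum a b n = altSum b a n := by
  have key : ∀ a b : A, ∑ j ∈ Finset.range n, altProdRev a b (j + 1) =
      ∑ j ∈ Finset.range n, altProdRev a b j + altProdRev a b n - 1 := by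
    intro a b
    rw [← Finset.sum_range_succ, Finset.sum_range_succ' _ n]
    simp [altProdRev]
  rw [altSum_eq, altSum_eq, key, key, altProdRev_comm_iff.2 h]
  abel

lemma altSum_mul {A : Type*} [Ring A] {a : A} {k : ℤ} (ha : a * a = (k - 1) • a + k • 1) (b : A)
    (n : ℕ) : altSum a b n * a = k • altSum a b n := by
  rw [altSum, mul_assoc, ← mul_smul_comm, add_mul, ha, one_mul, smul_add, sub_smul, one_smul]
  congr 1
  abel

/-! ### Local heights -/

namespace EdgeSystem

open Finsupp

variable {S V : Type*} (G : EdgeSystem S V)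

/-- The functional with values `g x` on the vertices is an eigenvector of `τ_s`, acting from the
right, for the eigenvalue `u²`, where `u = 3`. -/
def IsWeight (s : S) (g : V → ℤ) : Prop :=
  ∀ x, diagCoeff 3 (G.out s x) (G.dashed s x) * g x +
    offCoeff 3 (G.out s x) (G.dashed s x) * g (G.nb s x) = 9 * g x

variable {G}

lemma op_nonneg {s : S} {f : V →₀ ℤ} (hf : 0 ≤ f) : 0 ≤ G.op (3 : ℤ) s f := by
  rw [op, linearCombination_apply]
  refine Finset.sum_nonneg fun x _ => smul_nonneg (hf x) (add_nonneg ?_ ?_) <;>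
    rw [single_nonneg] <;> cases G.out s x <;> cases G.dashed s x <;>
    norm_num [diagCoeff, offCoeff]

lemma altProdRev_op_nonneg (n : ℕ) {s t : S} {f : V →₀ ℤ} (hf : 0 ≤ f) :
    0 ≤ altProdRev (G.op (3 : ℤ) s) (G.op (3 : ℤ) t) n f := by
  induction n generalizing s t f with
  | zero => exact hf
  | succ n ih => exact ih (op_nonneg hf)

/-- Two generators satisfying a braid relation have a common weight that does not vanish at `α`:
take the coefficient of `α` after applying the sum of the `T_w`, where `w` runs over the dihedral
group. It is positive at `α` because all entries of the operators are nonnegative for `u = 3`. -/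
lemma exists_isWeight {s t : S} {n : ℕ} (hn : n ≠ 0)
    (h : altProd (G.op (3 : ℤ) s) (G.op (3 : ℤ) t) n =
      altProd (G.op (3 : ℤ) t) (G.op (3 : ℤ) s) n) (α : V) :
    ∃ g : V → ℤ, g α ≠ 0 ∧ G.IsWeight s g ∧ G.IsWeight t g := by
  have key : ∀ r P, P * G.op (3 : ℤ) r = (9 : ℤ) • P →
      G.IsWeight r fun x => (P (single x (1 : ℤ))) α := by
    intro r P hP x
    have h1 := congrArg (fun f => f α) (LinearMap.congr_fun hP (single x (1 : ℤ)))
    have h2 : ∀ (y : V) (c : ℤ), P (single y c) = c • P (single y 1) := by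
      intro y c
      rw [← map_smul, smul_single, smul_eq_mul, mul_one]
    simp only [Module.End.mul_apply, op_single, map_add, one_mul] at h1
    rw [h2 x, h2 (G.nb r x)] at h1
    simpa using h1
  have hq : ∀ r, G.op (3 : ℤ) r * G.op 3 r = ((9 : ℤ) - 1) • G.op (3 : ℤ) r + (9 : ℤ) • 1 := by
    intro r
    have := G.op_mul_op (3 : ℤ) r
    norm_num at this ⊢
    exact this
  refine ⟨fun x => (altSum (G.op (3 : ℤ) s) (G.op 3 t) n (single x (1 : ℤ))) α, ?_,
    key s _ (altSum_mul (hq s) _ _), key t _ ?_⟩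
  · have h0 : (0 : V →₀ ℤ) ≤ single α 1 := single_nonneg.2 zero_le_one
    apply ne_of_gt
    beta_reduce
    rw [altSum_eq, LinearMap.add_apply, LinearMap.sum_apply, LinearMap.sum_apply, Finsupp.add_apply,
      finsetSum_apply, finsetSum_apply]
    refine add_pos_of_pos_of_nonneg ?_
      (Finset.sum_nonneg fun j _ => altProdRev_op_nonneg _ h0 α)
    refine Finset.sum_pos' (fun j _ => altProdRev_op_nonneg _ h0 α)
      ⟨0, Finset.mem_range.2 (Nat.pos_of_ne_zero hn), ?_⟩
    simp [altProdRev]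
  · rw [altSum_comm h]
    exact altSum_mul (hq t) _ _

/-- The amount by which heights rise along an edge. -/
def wt : Bool → ℕ
  | true => 1
  | false => 2

lemma wt_pos (d : Bool) : 0 < wt d := by cases d <;> decide

variable (G) in
/-- The set `N` is closed under the edges labeled `s`, and along these edges `h` rises by `2` on
solid and by `1` on dashed ones. -/
structure IsHeight (s : S) (N : Set V) (h : V → ℤ) : Prop where
  nb_mem : ∀ x ∈ N, G.nb s x ∈ N
  rise : ∀ x ∈ N, G.out s x = true → h (G.nb s x) = h x + wt (G.dashed s x)

/-- The `3`-adic valuation of a weight is a height: along an edge a weight is multiplied by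
`u² = 9` (solid) or by `(u² - u) / (u + 1) = 3 / 2` (dashed). -/
lemma IsWeight.isHeight {s : S} {g : V → ℤ} (hg : G.IsWeight s g) :
    G.IsHeight s {x | g x ≠ 0} fun x => padicValInt 3 (g x) where
  nb_mem x hx := by
    have := hg x
    intro h0
    rw [h0] at this
    apply hx
    cases ho : G.out s x <;> cases hd : G.dashed s x <;> simp [ho, hd, diagCoeff] at this <;>
      omega
  rise x hx ho := by
    have h := hg x
    change g x ≠ 0 at hx
    have : Fact (Nat.Prime 3) := ⟨Nat.prime_three⟩
    cases hd : G.dashed s x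
    · simp only [ho, hd, diagCoeff, offCoeff, zero_mul, zero_add, one_mul] at h
      rw [h, show (9 : ℤ) * g x = 3 * (3 * g x) by ring, padicValInt.mul (by norm_num) (by simpa),
        padicValInt.mul (by norm_num) hx, show padicValInt 3 3 = 1 from padicValInt_self]
      simp only [wt]; push_cast; ring
    · simp only [ho, hd, diagCoeff, offCoeff] at h
      have h' : (2 : ℤ) * g (G.nb s x) = 3 * g x := by linarith
      have hn : g (G.nb s x) ≠ 0 := by
        intro h0; rw [h0] at h'; omega
      have h2 : padicValInt 3 2 = 0 := padicValInt.eq_zero_of_not_dvd (by norm_num)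
      have := congrArg (padicValInt 3) h'
      rw [padicValInt.mul (by norm_num) hn, padicValInt.mul (by norm_num) hx, h2,
        show padicValInt 3 3 = 1 from padicValInt_self] at this
      simp only [wt]; push_cast; omega

end EdgeSystem

/-! ### Weighted relations with the diamond property -/

/-- `WPath R d x y`: there is a path of total weight `d` from `x` to `y`, where `R w x y` says that
there is an edge of weight `w` from `x` to `y`. -/
inductive WPath {V : Type*} (R : ℕ → V → V → Prop) : ℕ → V → V → Prop
  | refl (x : V) : WPath R 0 x x
  | snoc {d w : ℕ} {x y z : V} : WPath R d x y → R w y z → WPath R (d + w) x z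

/-- Any two edges with the same end can be completed, downwards, to two paths of equal weights with
the same start. -/
def Diamond {V : Type*} (R : ℕ → V → V → Prop) : Prop :=
  ∀ ⦃w₁ w₂ : ℕ⦄ ⦃β γ α : V⦄, R w₁ β α → R w₂ γ α →
    ∃ δ d₁ d₂, WPath R d₁ δ β ∧ WPath R d₂ δ γ ∧ d₁ + w₁ = d₂ + w₂

namespace WPath

variable {V : Type*} {R : ℕ → V → V → Prop}

lemma single {w : ℕ} {x y : V} (h : R w x y) : WPath R w x y := by
  simpa using (WPath.refl x).snoc h

lemma trans {d e : ℕ} {x y z : V} (h : WPath R d x y) (h' : WPath R e y z) :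
    WPath R (d + e) x z := by
  induction h' with
  | refl => simpa using h
  | snoc _ hR ih => rw [← add_assoc]; exact (ih h).snoc hR

/-- Paths from a source: if `x` is reached with weight `e`, then every predecessor of `x` is
reached with the correspondingly smaller weight. -/
lemma of_edge (hR : Diamond R) (hpos : ∀ w x y, R w x y → 0 < w) {σ : V}
    (hσ : ∀ w x, ¬ R w x σ) : ∀ (e : ℕ) (x : V), WPath R e σ x →
      ∀ w y, R w y x → ∃ e', WPath R e' σ y ∧ e' + w = e := by
  intro e
  induction e using Nat.strong_induction_on with
  | _ e ih =>
    intro x hx w y hy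
    cases hx with
    | refl => exact absurd hy (hσ _ _)
    | @snoc e₀ w₀ _ z _ hz hzx =>
      -- going down a path that ends below weight `e`, all weights stay below `e`
      have back : ∀ d δ z, WPath R d δ z → ∀ e₁, e₁ < e₀ + w₀ → WPath R e₁ σ z →
          ∃ e', WPath R e' σ δ ∧ e' + d = e₁ := by
        intro d δ z h
        induction h with
        | refl => exact fun e₁ _ h => ⟨e₁, h, rfl⟩
        | snoc _ hR' ihp =>
          intro e₁ he₁ h
          obtain ⟨e', h', rfl⟩ := ih e₁ he₁ _ h _ _ hR'
          obtain ⟨e'', h'', rfl⟩ := ihp e' (by omega) h'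
          exact ⟨e'', h'', by omega⟩
      obtain ⟨δ, d₁, d₂, h₁, h₂, hd⟩ := hR hzx hy
      obtain ⟨e', h', he'⟩ := back d₁ δ z h₁ e₀ (by have := hpos _ _ _ hzx; omega) hz
      exact ⟨e' + d₂, h'.trans h₂, by omega⟩

lemma of_path (hR : Diamond R) (hpos : ∀ w x y, R w x y → 0 < w) {σ : V}
    (hσ : ∀ w x, ¬ R w x σ) {d : ℕ} {y x : V} (h : WPath R d y x) {e : ℕ} (hx : WPath R e σ x) :
    ∃ e', WPath R e' σ y ∧ e' + d = e := by
  induction h generalizing e with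
  | refl => exact ⟨e, hx, rfl⟩
  | snoc _ hE ih =>
    obtain ⟨e', h', rfl⟩ := of_edge hR hpos hσ e _ hx _ _ hE
    obtain ⟨e'', h'', rfl⟩ := ih h'
    exact ⟨e'', h'', by omega⟩

lemma exists_of_source (hR : Diamond R) (hpos : ∀ w x y, R w x y → 0 < w) {σ : V}
    (hσ : ∀ w x, ¬ R w x σ)
    (hconn : ∀ x y, Relation.ReflTransGen (fun a b => (∃ w, R w a b) ∨ ∃ w, R w b a) x y) (x : V) :
    ∃ e, WPath R e σ x := by
  induction hconn σ x with
  | refl => exact ⟨0, .refl σ⟩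
  | tail _ h ih =>
    obtain ⟨e, he⟩ := ih
    rcases h with ⟨w, h⟩ | ⟨w, h⟩
    · exact ⟨_, he.snoc h⟩
    · obtain ⟨e', h', -⟩ := of_edge hR hpos hσ e _ he _ _ h
      exact ⟨e', h'⟩

lemma source_unique (hR : Diamond R) (hpos : ∀ w x y, R w x y → 0 < w) {σ σ' : V}
    (hσ : ∀ w x, ¬ R w x σ) (hσ' : ∀ w x, ¬ R w x σ')
    (hconn : ∀ x y, Relation.ReflTransGen (fun a b => (∃ w, R w a b) ∨ ∃ w, R w b a) x y) :
    σ = σ' := by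
  obtain ⟨e, he⟩ := exists_of_source hR hpos hσ hconn σ'
  cases he with
  | refl => rfl
  | snoc _ h => exact absurd h (hσ' _ _)

/-- A circuit through `x` would allow to lower the weight of paths from the source to `x`
indefinitely. -/
lemma acyclic_of_source (hR : Diamond R) (hpos : ∀ w x y, R w x y → 0 < w) {σ : V}
    (hσ : ∀ w x, ¬ R w x σ)
    (hconn : ∀ x y, Relation.ReflTransGen (fun a b => (∃ w, R w a b) ∨ ∃ w, R w b a) x y) (x : V) :
    ¬ Relation.TransGen (fun a b => ∃ w, R w a b) x x := by
  intro h
  have hpath : ∀ y, Relation.TransGen (fun a b => ∃ w, R w a b) x y →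
      ∃ d, 0 < d ∧ WPath R d x y := by
    intro y hy
    induction hy with
    | single h => obtain ⟨w, h⟩ := h; exact ⟨w, hpos _ _ _ h, single h⟩
    | tail _ h ih =>
      obtain ⟨d, hd, hp⟩ := ih
      obtain ⟨w, h⟩ := h
      exact ⟨d + w, by omega, hp.snoc h⟩
  obtain ⟨d, hd, hp⟩ := hpath x h
  have key : ∀ e, ¬ WPath R e σ x := by
    intro e
    induction e using Nat.strong_induction_on with
    | _ e ih =>
      intro he
      obtain ⟨e', h', rfl⟩ := of_path hR hpos hσ hp he
      exact ih e' (by omega) h'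
  obtain ⟨e, he⟩ := exists_of_source hR hpos hσ hconn x
  exact key e he

end WPath

/-! ### Moving to the lower or upper ends of edges -/

/-- Modulo `3`, the operator `a` sends each basis vector `x` to `f x` or to its negative. -/
def SignedMod {V : Type*} (a : Module.End ℤ (V →₀ ℤ)) (f : Function.End V) : Prop :=
  ∀ x, ∃ ε : ℤ, (ε = 1 ∨ ε = -1) ∧ ∃ r : V →₀ ℤ,
    a (Finsupp.single x 1) = Finsupp.single (f x) ε + (3 : ℤ) • r

namespace SignedMod

variable {V : Type*} {a b : Module.End ℤ (V →₀ ℤ)} {f g : Function.End V}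

lemma mul (ha : SignedMod a f) (hb : SignedMod b g) : SignedMod (a * b) (f * g) := by
  intro x
  obtain ⟨ε, hε, r, hr⟩ := hb x
  obtain ⟨ε', hε', r', hr'⟩ := ha (g x)
  refine ⟨ε * ε', ?_, ε • r' + a r, ?_⟩
  · rcases hε with rfl | rfl <;> rcases hε' with rfl | rfl <;> simp
  · have h : Finsupp.single (g x) ε = ε • Finsupp.single (g x) (1 : ℤ) := by simp
    rw [Module.End.mul_apply, hr, map_add, map_smul, h, map_smul, hr', smul_add, smul_add,
      Finsupp.smul_single, smul_eq_mul, smul_comm ε, add_assoc]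
    rfl

lemma altProd (ha : SignedMod a f) (hb : SignedMod b g) (n : ℕ) :
    SignedMod (altProd a b n) (altProd f g n) := by
  induction n generalizing a b f g with
  | zero => exact fun x => ⟨1, Or.inl rfl, 0, by rw [smul_zero, add_zero]; rfl⟩
  | succ n ih => exact ha.mul (ih hb ha)

lemma unique (ha : SignedMod a f) (hb : SignedMod a g) : f = g := by
  funext x
  by_contra hne
  obtain ⟨ε, hε, r, hr⟩ := ha x
  obtain ⟨ε', hε', r', hr'⟩ := hb x
  have h := congrArg (fun v => v (f x)) (hr.symm.trans hr')
  simp [Finsupp.single_eq_of_ne hne] at h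
  omega

end SignedMod

namespace EdgeSystem

open Finsupp

variable {S V : Type*} (G : EdgeSystem S V)

/-- The system obtained by reversing all edges. -/
def rev : EdgeSystem S V where
  nb := G.nb
  out s x := !G.out s x
  dashed := G.dashed
  nb_nb := G.nb_nb
  out_nb s x := by rw [G.out_nb]
  dashed_nb := G.dashed_nb

/-- The starting vertex of the edge labeled `s` at a vertex. -/
def low (s : S) : Function.End V := fun x => if G.out s x = true then x else G.nb s x

/-- The operator `u² - 1 - τ_s = -u² τ_s⁻¹` for `u = 3`. -/
def coOp (s : S) : Module.End ℤ (V →₀ ℤ) := (8 : ℤ) • 1 - G.op 3 s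

/-- The transpose of `coOp`. -/
def coOpT (s : S) : Module.End ℤ (V →₀ ℤ) :=
  Finsupp.linearCombination ℤ fun x =>
    single x (8 - diagCoeff 3 (G.out s x) (G.dashed s x)) -
      single (G.nb s x) (offCoeff 3 (!G.out s x) (G.dashed s x))

/-- Modulo `3`, that is for `u = 0`, the operator `τ_s` moves to the upper end of the edge labeled
`s`, up to sign. -/
lemma signedMod_op (s : S) : SignedMod (G.op 3 s) (G.rev.low s) := by
  intro x
  rw [op_single]
  cases ho : G.out s x <;> cases hd : G.dashed s x <;>
    simp only [low, rev, ho, Bool.not_true, Bool.not_false, if_true, Bool.false_eq_true, if_false,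
      diagCoeff, offCoeff, one_mul]
  · refine ⟨-1, Or.inr rfl, single x 3 + single (G.nb s x) 3, ?_⟩
    rw [smul_add, smul_single, smul_single, ← add_assoc, ← single_add]
    norm_num
  · refine ⟨-1, Or.inr rfl, single x 2 + single (G.nb s x) 2, ?_⟩
    rw [smul_add, smul_single, smul_single, ← add_assoc, ← single_add]
    norm_num
  · exact ⟨1, Or.inl rfl, 0, by simp⟩
  · refine ⟨1, Or.inl rfl, single x 1 + single (G.nb s x) 1, ?_⟩
    rw [smul_add, smul_single, smul_single, add_left_comm, ← single_add]
    norm_num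

/-- Modulo `3`, the transpose of `-u² τ_s⁻¹` moves to the lower end of the edge labeled `s`, up to
sign. -/
lemma signedMod_coOpT (s : S) : SignedMod (G.coOpT s) (G.low s) := by
  intro x
  rw [coOpT, linearCombination_single, one_smul]
  cases ho : G.out s x <;> cases hd : G.dashed s x <;>
    simp only [low, ho, Bool.not_true, Bool.not_false, if_true, Bool.false_eq_true, if_false,
      diagCoeff, offCoeff]
  · exact ⟨-1, Or.inr rfl, 0, by norm_num⟩
  · refine ⟨-1, Or.inr rfl, single x 1 - single (G.nb s x) 1, ?_⟩
    rw [smul_sub, smul_single, smul_single, add_sub_left_comm, ← single_sub]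
    norm_num [sub_eq_add_neg]
  · refine ⟨-1, Or.inr rfl, single x 3 - single (G.nb s x) 3, ?_⟩
    rw [smul_sub, smul_single, smul_single, ← add_sub_assoc, ← single_add]
    norm_num
  · refine ⟨-1, Or.inr rfl, single x 2 - single (G.nb s x) 2, ?_⟩
    rw [smul_sub, smul_single, smul_single, ← add_sub_assoc, ← single_add]
    norm_num

variable {G}

lemma IsWeight.mul_offCoeff {s : S} {g : V → ℤ} (hg : G.IsWeight s g) (x : V) :
    g x * offCoeff 3 (!G.out s x) (G.dashed s x) =
      offCoeff 3 (G.out s x) (G.dashed s x) * g (G.nb s x) := by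
  have := hg x
  cases ho : G.out s x <;> cases hd : G.dashed s x <;>
    simp [ho, hd, diagCoeff, offCoeff] at this ⊢ <;> omega

/-- Rescaling the basis by a weight intertwines the operators with their transposes. -/
lemma IsWeight.coOpT_comm {s : S} {g : V → ℤ} (hg : G.IsWeight s g) (f : V →₀ ℤ) :
    Finsupp.linearCombination ℤ (fun x => single x (g x)) (G.coOp s f) =
      G.coOpT s (Finsupp.linearCombination ℤ (fun x => single x (g x)) f) := by
  induction f using Finsupp.induction_linear with
  | zero => simp
  | add f f' hf hf' => simp only [map_add, hf, hf']
  | single x c =>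
    have h := hg.mul_offCoeff x
    simp only [coOp, coOpT, LinearMap.sub_apply, LinearMap.smul_apply, Module.End.one_apply,
      op_single, map_sub, map_add, linearCombination_single, smul_single, smul_eq_mul,
      smul_sub, mul_assoc, h]
    rw [sub_add_eq_sub_sub, ← single_sub]
    congr 2
    ring

lemma coOp_braid {s t : S} {n : ℕ} (h : altProd (G.op (3 : ℤ) s) (G.op (3 : ℤ) t) n =
    altProd (G.op (3 : ℤ) t) (G.op (3 : ℤ) s) n) :
    altProd (G.coOp s) (G.coOp t) n = altProd (G.coOp t) (G.coOp s) n := by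
  have h1 : ∀ r, G.op 3 r * G.coOp r = ((-9 : ℤ) : Module.End ℤ (V →₀ ℤ)) := by
    intro r
    have := G.op_mul_op (3 : ℤ) r
    norm_num at this
    rw [coOp, mul_sub, this, mul_smul_comm, mul_one]
    simp
  have h2 : ∀ r, G.coOp r * G.op 3 r = ((-9 : ℤ) : Module.End ℤ (V →₀ ℤ)) := by
    intro r
    have := G.op_mul_op (3 : ℤ) r
    norm_num at this
    rw [coOp, sub_mul, this, smul_mul_assoc, one_mul]
    simp
  have : IsAddTorsionFree (Module.End ℤ (V →₀ ℤ)) := by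
    refine ⟨fun n hn a b hab => LinearMap.ext fun f => ?_⟩
    have := LinearMap.congr_fun hab f
    simpa [hn] using this
  exact altProd_comm_of_mul_eq (by norm_num) (h1 s) (h2 s) (h1 t) (h2 t) h

lemma rev_low_braid {s t : S} {n : ℕ} (h : altProd (G.op (3 : ℤ) s) (G.op (3 : ℤ) t) n =
    altProd (G.op (3 : ℤ) t) (G.op (3 : ℤ) s) n) :
    altProd (G.rev.low s) (G.rev.low t) n = altProd (G.rev.low t) (G.rev.low s) n := by
  have h1 := (G.signedMod_op s).altProd (G.signedMod_op t) n
  rw [h] at h1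
  exact h1.unique ((G.signedMod_op t).altProd (G.signedMod_op s) n)

lemma low_braid {s t : S} {n : ℕ} (hn : n ≠ 0)
    (h : altProd (G.op (3 : ℤ) s) (G.op (3 : ℤ) t) n =
      altProd (G.op (3 : ℤ) t) (G.op (3 : ℤ) s) n) :
    altProd (G.low s) (G.low t) n = altProd (G.low t) (G.low s) n := by
  have key : altProd (G.coOpT s) (G.coOpT t) n = altProd (G.coOpT t) (G.coOpT s) n := by
    refine Finsupp.lhom_ext fun α c => ?_
    obtain ⟨g, hα, hs, ht⟩ := exists_isWeight hn h α
    have h1 := altProd_intertwine _ n hs.coOpT_comm ht.coOpT_comm (single α c)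
    rw [coOp_braid h, altProd_intertwine _ n ht.coOpT_comm hs.coOpT_comm] at h1
    have h2 : Finsupp.linearCombination ℤ (fun x => single x (g x)) (single α c) =
        g α • single α c := by simp [mul_comm]
    rw [h2, map_smul, map_smul] at h1
    exact (smul_right_injective _ hα h1).symm
  have h1 := (G.signedMod_coOpT s).altProd (G.signedMod_coOpT t) n
  rw [key] at h1
  exact h1.unique ((G.signedMod_coOpT t).altProd (G.signedMod_coOpT s) n)

/-! ### The diamond property -/

variable (G) in
/-- There is an edge of weight `w` from `x` to `y`. -/
def Edge (w : ℕ) (x y : V) : Prop :=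
  ∃ s, G.out s x = true ∧ G.nb s x = y ∧ wt (G.dashed s x) = w

lemma Edge.pos {w : ℕ} {x y : V} (h : G.Edge w x y) : 0 < w := by
  obtain ⟨s, -, -, rfl⟩ := h
  exact wt_pos _

lemma rev_edge {w : ℕ} {x y : V} : G.rev.Edge w x y ↔ G.Edge w y x := by
  have key : ∀ (G : EdgeSystem S V) {x y : V}, G.Edge w y x → G.rev.Edge w x y := by
    rintro G x y ⟨s, h1, rfl, h2⟩
    exact ⟨s, by simp [rev, G.out_nb, h1], by simp [rev, G.nb_nb], by simpa [rev, G.dashed_nb]⟩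
  refine ⟨fun h => ?_, key G⟩
  have h' := key G.rev h
  obtain ⟨s, h1, h2⟩ := h'
  exact ⟨s, by simpa [rev] using h1, h2⟩

lemma IsHeight.rev {s : S} {N : Set V} {h : V → ℤ} (hh : G.IsHeight s N h) :
    G.rev.IsHeight s N fun x => -h x where
  nb_mem := hh.nb_mem
  rise x hx ho := by
    have h1 : G.out s (G.nb s x) = true := by rw [G.out_nb]; exact ho
    have h2 := hh.rise _ (hh.nb_mem x hx) h1
    rw [G.nb_nb, G.dashed_nb] at h2
    simp only [EdgeSystem.rev]
    omega

lemma IsHeight.low_path {s : S} {N : Set V} {h : V → ℤ} (hh : G.IsHeight s N h) {x : V}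
    (hx : x ∈ N) :
    G.low s x ∈ N ∧ ∃ d : ℕ, WPath G.Edge d (G.low s x) x ∧ h x = h (G.low s x) + d := by
  cases ho : G.out s x
  · have h1 := hh.nb_mem x hx
    have h2 : G.out s (G.nb s x) = true := by rw [G.out_nb, ho]; rfl
    have h3 := hh.rise _ h1 h2
    rw [G.nb_nb] at h3
    simp only [low, ho, Bool.false_eq_true, if_false]
    exact ⟨h1, _, .single ⟨s, h2, G.nb_nb s x, rfl⟩, h3⟩
  · simp only [low, ho, if_true]
    exact ⟨hx, 0, .refl x, by simp⟩

lemma low_path_of_mem_closure {s t : S} {N : Set V} {h : V → ℤ} (hs : G.IsHeight s N h)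
    (ht : G.IsHeight t N h) {X : Function.End V}
    (hX : X ∈ Submonoid.closure {G.low s, G.low t}) :
    ∀ x ∈ N, X x ∈ N ∧ ∃ d : ℕ, WPath G.Edge d (X x) x ∧ h x = h (X x) + d := by
  induction hX using Submonoid.closure_induction with
  | mem X hX =>
    rcases hX with rfl | rfl
    · exact fun x => hs.low_path
    · exact fun x => ht.low_path
  | one => exact fun x hx => ⟨hx, 0, .refl x, (add_zero _).symm⟩
  | mul X Y _ _ hX hY =>
    intro x hx
    obtain ⟨h1, d, h2, h3⟩ := hY x hx
    obtain ⟨h1', d', h2', h3'⟩ := hX _ h1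
    refine ⟨h1', d' + d, h2'.trans h2, ?_⟩
    rw [h3, h3']
    push_cast
    exact (add_assoc _ _ _)

lemma altProd_mem_closure {A : Type*} [Monoid A] (n : ℕ) (a b : A) :
    altProd a b n ∈ Submonoid.closure {a, b} := by
  induction n generalizing a b with
  | zero => exact one_mem _
  | succ n ih =>
    exact mul_mem (Submonoid.subset_closure (Set.mem_insert _ _)) (Set.pair_comm b a ▸ ih b a)

/-- Two edges ending at `α` with labels `s` and `t`: the two alternating sequences of moves to lower
ends meet, and heights show that the two paths obtained have the same weight. -/
lemma diamond_of_height {s t : S} {n : ℕ}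
    (hb : altProd (G.low s) (G.low t) (n + 1) = altProd (G.low t) (G.low s) (n + 1))
    {N : Set V} {h : V → ℤ} (hs : G.IsHeight s N h) (ht : G.IsHeight t N h) {α : V} (hα : α ∈ N)
    (hsα : G.out s α = false) (htα : G.out t α = false) :
    ∃ δ d₁ d₂, WPath G.Edge d₁ δ (G.nb s α) ∧ WPath G.Edge d₂ δ (G.nb t α) ∧
      d₁ + wt (G.dashed s α) = d₂ + wt (G.dashed t α) := by
  obtain ⟨X, hX, Y, hY, hXY⟩ : ∃ X ∈ Submonoid.closure {G.low s, G.low t},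
      ∃ Y ∈ Submonoid.closure {G.low s, G.low t}, X * G.low s = Y * G.low t := by
    have h1 := altProd_mem_closure n (G.low s) (G.low t)
    have h2 := altProd_mem_closure n (G.low t) (G.low s)
    rw [Set.pair_comm] at h2
    rw [altProd_succ_right, altProd_succ_right] at hb
    split_ifs at hb
    · exact ⟨_, h1, _, h2, hb⟩
    · exact ⟨_, h2, _, h1, hb.symm⟩
  have hXY' : X (G.nb s α) = Y (G.nb t α) := by
    have := congrFun hXY α
    change X (G.low s α) = Y (G.low t α) at this
    simpa [low, hsα, htα] using this
  have rise : ∀ r, G.IsHeight r N h → G.out r α = false →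
      h α = h (G.nb r α) + wt (G.dashed r α) := by
    intro r hr ho
    have := hr.rise _ (hr.nb_mem α hα) (by rw [G.out_nb, ho]; rfl)
    rwa [G.nb_nb, G.dashed_nb] at this
  obtain ⟨-, d₁, hp₁, hd₁⟩ := low_path_of_mem_closure hs ht hX _ (hs.nb_mem α hα)
  obtain ⟨-, d₂, hp₂, hd₂⟩ := low_path_of_mem_closure hs ht hY _ (ht.nb_mem α hα)
  rw [← hXY'] at hp₂ hd₂
  have e1 := rise s hs hsα
  have e2 := rise t ht htα
  exact ⟨_, d₁, d₂, hp₁, hp₂, by omega⟩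

lemma diamond_of_braid (hb : ∀ s t, s ≠ t → ∃ n,
      altProd (G.low s) (G.low t) (n + 1) = altProd (G.low t) (G.low s) (n + 1))
    (hh : ∀ s t α, s ≠ t → ∃ N h, α ∈ N ∧ G.IsHeight s N h ∧ G.IsHeight t N h) :
    Diamond G.Edge := by
  rintro w₁ w₂ β γ α ⟨s, hs1, hs2, rfl⟩ ⟨t, ht1, ht2, rfl⟩
  have e1 : G.nb s α = β := by rw [← hs2, G.nb_nb]
  have e2 : G.nb t α = γ := by rw [← ht2, G.nb_nb]
  by_cases hst : s = t
  · subst hst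
    obtain rfl : β = γ := e1.symm.trans e2
    exact ⟨β, 0, 0, .refl β, .refl β, rfl⟩
  · obtain ⟨n, hn⟩ := hb s t hst
    obtain ⟨N, h, hα, hs, ht⟩ := hh s t α hst
    have := diamond_of_height hn hs ht hα (by rw [← hs2, G.out_nb, hs1]; rfl)
      (by rw [← ht2, G.out_nb, ht1]; rfl)
    have d1 : G.dashed s α = G.dashed s β := by rw [← hs2, G.dashed_nb]
    have d2 : G.dashed t α = G.dashed t γ := by rw [← ht2, G.dashed_nb]
    rwa [e1, e2, d1, d2] at this

variable {M : CoxeterMatrix S}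

lemma Braided.exists_isHeight (hM : ∀ s t, M s t ≠ 0) (hG : G.Braided M (3 : ℤ)) (s t : S) (α : V)
    (hst : s ≠ t) : ∃ N h, α ∈ N ∧ G.IsHeight s N h ∧ G.IsHeight t N h := by
  obtain ⟨g, hα, hs, ht⟩ := exists_isWeight (hM s t) (hG s t hst) α
  exact ⟨_, _, hα, hs.isHeight, ht.isHeight⟩

lemma Braided.diamond (hM : ∀ s t, M s t ≠ 0) (hG : G.Braided M (3 : ℤ)) : Diamond G.Edge := by
  refine diamond_of_braid (fun s t hst => ⟨M s t - 1, ?_⟩) (hG.exists_isHeight hM)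
  rw [Nat.sub_add_cancel (Nat.pos_of_ne_zero (hM s t))]
  exact low_braid (hM s t) (hG s t hst)

lemma Braided.diamond_rev (hM : ∀ s t, M s t ≠ 0) (hG : G.Braided M (3 : ℤ)) :
    Diamond G.rev.Edge := by
  refine diamond_of_braid (fun s t hst => ⟨M s t - 1, ?_⟩) fun s t α hst => ?_
  · rw [Nat.sub_add_cancel (Nat.pos_of_ne_zero (hM s t))]
    exact rev_low_braid (hG s t hst)
  · obtain ⟨N, h, hα, hs, ht⟩ := hG.exists_isHeight hM s t α hst
    exact ⟨N, _, hα, hs.rev, ht.rev⟩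

end EdgeSystem

/-! ### Generators that are involutions modulo `2` -/

lemma pow_mul_self_mul_pow {A : Type*} [Monoid A] {a b : A} (ha : a * a = 1) (hb : b * b = 1)
    (n : ℕ) : (a * b) ^ n * a * (a * b) ^ n = a := by
  induction n with
  | zero => simp
  | succ n ih =>
    calc (a * b) ^ (n + 1) * a * (a * b) ^ (n + 1)
        = (a * b) ^ n * (a * b) * a * (a * b * (a * b) ^ n) := by rw [← pow_succ, ← pow_succ']
      _ = (a * b) ^ n * (a * (b * (a * a) * b)) * (a * b) ^ n := by simp only [mul_assoc]
      _ = a := by rw [ha, mul_one, hb, mul_one, ih]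

lemma pow_mul_altProd {A : Type*} [Monoid A] {a b : A} (ha : a * a = 1) (hb : b * b = 1) :
    ∀ n, (a * b) ^ n * altProd b a n = altProd a b n
  | 0 => by simp [altProd]
  | n + 1 => by
      have ih := pow_mul_altProd ha hb n
      calc (a * b) ^ (n + 1) * altProd b a (n + 1)
          = (a * b) ^ n * a * (b * b) * altProd a b n := by
            simp only [altProd, pow_succ, mul_assoc]
        _ = (a * b) ^ n * a * (a * b) ^ n * altProd b a n := by
            rw [hb, mul_one, ← ih]; simp only [mul_assoc]
        _ = altProd a b (n + 1) := by rw [pow_mul_self_mul_pow ha hb]; rfl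

lemma exists_altProd_mul_eq_one {A : Type*} [Monoid A] :
    ∀ (n : ℕ) {a b : A}, a * a = 1 → b * b = 1 → ∃ c, altProd a b n * c = 1
  | 0, _, _, _, _ => ⟨1, by simp [altProd]⟩
  | n + 1, a, b, ha, hb => by
      obtain ⟨c, hc⟩ := exists_altProd_mul_eq_one n hb ha
      exact ⟨c * a, by rw [altProd, mul_assoc, ← mul_assoc _ c, hc, one_mul, ha]⟩

/-- For involutions, the braid relation of length `n` says that `a * b` has order dividing `n`. -/
lemma mul_pow_eq_one_of_braid {A : Type*} [Monoid A] {a b : A} (ha : a * a = 1) (hb : b * b = 1)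
    {n : ℕ} (h : altProd a b n = altProd b a n) : (a * b) ^ n = 1 := by
  obtain ⟨c, hc⟩ := exists_altProd_mul_eq_one n hb ha
  have := pow_mul_altProd ha hb n
  rw [h] at this
  calc (a * b) ^ n = (a * b) ^ n * altProd b a n * c := by rw [mul_assoc, hc, mul_one]
    _ = 1 := by rw [this, hc]

/-- Congruence modulo `2` in a ring, as a congruence of its multiplicative monoid. -/
def conTwo (A : Type*) [Ring A] : Con A where
  r a b := ∃ r, a - b = 2 * r
  iseqv :=
    { refl := fun a => ⟨0, by simp⟩
      symm := fun {a b} ⟨r, h⟩ => ⟨-r, by rw [mul_neg, ← h, neg_sub]⟩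
      trans := fun {a b c} ⟨r, h⟩ ⟨r', h'⟩ => ⟨r + r', by rw [mul_add, ← h, ← h']; abel⟩ }
  mul' := by
    rintro a b c d ⟨r, h⟩ ⟨r', h'⟩
    refine ⟨r * c + b * r', ?_⟩
    have h2 : b * (2 * r') = 2 * (b * r') := by
      rw [← mul_assoc, ← mul_assoc, (Commute.ofNat_right b 2).eq]
    rw [mul_add, ← mul_assoc, ← h, ← h2, ← h']
    noncomm_ring

section Generation

variable {S W A : Type*} [Ring A] {T : S → A}

/-- If the generators of `A` satisfy the braid relations, and are involutions modulo `2`, then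
modulo `2` they define a homomorphism on `W`, so that `A` is spanned modulo `2` by `|W|` elements.
-/
lemma exists_span_mod_two [Group W] {M : CoxeterMatrix S} (cs : CoxeterSystem M W) [Fintype W]
    (htop : Subring.closure (Set.range T) = ⊤)
    (hT : ∀ s, ∃ r, T s * T s - 1 = 2 * r)
    (hb : ∀ s t, s ≠ t → altProd (T s) (T t) (M s t) = altProd (T t) (T s) (M s t)) :
    ∃ n : W → A, ∀ a, ∃ (c : W → ℤ) (r : A), a = ∑ w, c w • n w + (2 : ℤ) • r := by
  have hinv : ∀ s, (conTwo A).mk' (T s) * (conTwo A).mk' (T s) = 1 := by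
    intro s
    rw [← map_mul, ← map_one (conTwo A).mk']
    exact (Con.eq _).2 (hT s)
  have hlift : M.IsLiftable fun s => (conTwo A).mk' (T s) := by
    intro s t
    by_cases hst : s = t
    · subst hst
      rw [M.diagonal, pow_one]
      exact hinv s
    · refine mul_pow_eq_one_of_braid (hinv s) (hinv t) ?_
      rw [← map_altProd, ← map_altProd, hb s t hst]
  let Q : W →* (conTwo A).Quotient := cs.lift ⟨_, hlift⟩
  have hQ : ∀ s, Q (cs.simple s) = (conTwo A).mk' (T s) := fun s => cs.lift_apply_simple hlift s
  choose n hn using fun w => Con.mk'_surjective (c := conTwo A) (Q w)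
  refine ⟨n, fun a => ?_⟩
  have hmon : ∀ m ∈ Submonoid.closure (Set.range T), ∃ w, (conTwo A).mk' m = Q w := by
    intro m hm
    induction hm using Submonoid.closure_induction with
    | mem m hm => obtain ⟨s, rfl⟩ := hm; exact ⟨_, (hQ s).symm⟩
    | one => exact ⟨1, by simp⟩
    | mul m m' _ _ h h' =>
      obtain ⟨w, h⟩ := h
      obtain ⟨w', h'⟩ := h'
      exact ⟨w * w', by rw [map_mul, map_mul, h, h']⟩
  have ha : a ∈ Subring.closure (Set.range T) := htop ▸ Subring.mem_top a
  rw [Subring.mem_closure_iff] at ha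
  induction ha using AddSubgroup.closure_induction with
  | mem m hm =>
    classical
    obtain ⟨w, hw⟩ := hmon m hm
    rw [← hn w] at hw
    obtain ⟨r, hr⟩ := (Con.eq _).1 hw
    refine ⟨Pi.single w 1, r, ?_⟩
    rw [Finset.sum_eq_single w (fun w' _ h => by simp [h]) (by simp), Pi.single_eq_same, one_smul,
      zsmul_eq_mul]
    push_cast
    rw [← hr]
    abel
  | zero => exact ⟨0, 0, by simp⟩
  | add a b _ _ h h' =>
    obtain ⟨c, r, rfl⟩ := h
    obtain ⟨c', r', rfl⟩ := h'
    refine ⟨c + c', r + r', ?_⟩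
    simp only [Pi.add_apply, add_smul, Finset.sum_add_distrib, smul_add]
    abel
  | neg a _ h =>
    obtain ⟨c, r, rfl⟩ := h
    exact ⟨-c, -r, by simp only [Pi.neg_apply, neg_smul, Finset.sum_neg_distrib, smul_neg]; abel⟩

lemma exists_span_mod_two_pow {n : W → A} [Fintype W]
    (hn : ∀ a, ∃ (c : W → ℤ) (r : A), a = ∑ w, c w • n w + (2 : ℤ) • r) (k : ℕ) :
    ∀ a, ∃ (c : W → ℤ) (r : A), a = ∑ w, c w • n w + (2 ^ k : ℤ) • r := by
  induction k with
  | zero => exact fun a => ⟨0, a, by simp⟩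
  | succ k ih =>
    intro a
    obtain ⟨c, r, rfl⟩ := hn a
    obtain ⟨c', r', rfl⟩ := ih r
    refine ⟨c + (2 : ℤ) • c', r', ?_⟩
    simp only [Pi.add_apply, Pi.smul_apply, smul_eq_mul, add_smul, mul_smul,
      Finset.sum_add_distrib, smul_add, Finset.smul_sum, pow_succ']
    abel

end Generation

/-- An integer matrix that is congruent modulo `m` to a product `A * N` with `det A = 0` has
determinant divisible by `m`. -/
lemma dvd_det_of_eq_mul_add {ι : Type*} [Fintype ι] [DecidableEq ι] {D A N Y : Matrix ι ι ℤ}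
    {m : ℕ} (h : ∀ i j, D i j = ∑ l, A i l * N l j + m * Y i j) (hA : A.det = 0) :
    (m : ℤ) ∣ D.det := by
  rw [← ZMod.intCast_zmod_eq_zero_iff_dvd, ← eq_intCast (Int.castRingHom (ZMod m)), RingHom.map_det]
  have : (Int.castRingHom (ZMod m)).mapMatrix D = (Int.castRingHom (ZMod m)).mapMatrix (A * N) := by
    ext i j
    simp [h, Matrix.mul_apply]
  rw [this, ← RingHom.map_det, Matrix.det_mul, hA, zero_mul, map_zero]

namespace EdgeSystem

open Finsupp

variable {S V W : Type*} [Group W] {M : CoxeterMatrix S} {G : EdgeSystem S V}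

lemma offCoeff_ne_zero (o d : Bool) : offCoeff (3 : ℤ) o d ≠ 0 := by
  cases o <;> cases d <;> norm_num [offCoeff]

/-- If `W` is finite, then no infinite walk is injective. Nonzero multiples of all
vertices of the walk lie in the module generated by its first vertex, and modulo each power of `2`
this module is spanned by `|W|` elements. For `|W| + 1` vertices of the walk, a nonzero
determinant would thus be divisible by all powers of `2`. -/
lemma Braided.not_injective_walk [Finite W] (cs : CoxeterSystem M W) (hG : G.Braided M (3 : ℤ))
    {x : ℕ → V} (hx : ∀ i, ∃ s, G.nb s (x i) = x (i + 1)) : ¬ Function.Injective x := by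
  intro hinj
  have := Fintype.ofFinite W
  classical
  set A := Subring.closure (Set.range (G.op (3 : ℤ)))
  let T : S → A := fun s => ⟨G.op 3 s, Subring.subset_closure ⟨s, rfl⟩⟩
  have htop : Subring.closure (Set.range T) = ⊤ := by
    refine (Subring.eq_top_iff' _).2 fun a => ?_
    have ha : a.1 ∈ (Subring.closure (Set.range T)).map A.subtype := by
      rw [RingHom.map_closure, ← Set.range_comp]
      exact a.2
    obtain ⟨b, hb, hba⟩ := ha
    rwa [← Subtype.ext hba]
  have hT : ∀ s, ∃ r, T s * T s - 1 = 2 * r := by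
    intro s
    refine ⟨4 * T s + 4, Subtype.ext ?_⟩
    have := G.op_mul_op (3 : ℤ) s
    norm_num at this
    change G.op 3 s * G.op 3 s - 1 = 2 * (4 * G.op 3 s + 4)
    rw [this, add_sub_assoc, show (9 : Module.End ℤ (V →₀ ℤ)) - 1 = 2 * 4 by norm_num]
    noncomm_ring
  have hb : ∀ s t, s ≠ t → altProd (T s) (T t) (M s t) = altProd (T t) (T s) (M s t) := by
    intro s t hst
    apply Subtype.ext
    rw [← Subring.coe_subtype, map_altProd, map_altProd]
    exact hG s t hst
  obtain ⟨n, hn⟩ := exists_span_mod_two cs htop hT hb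
  have hwalk : ∀ i, ∃ (c : ℤ) (r : A), c ≠ 0 ∧ r.1 (single (x 0) 1) = single (x i) c := by
    intro i
    induction i with
    | zero => exact ⟨1, 1, one_ne_zero, rfl⟩
    | succ i ih =>
      obtain ⟨c, r, hc, hr⟩ := ih
      obtain ⟨s, hs⟩ := hx i
      refine ⟨c * offCoeff 3 (G.out s (x i)) (G.dashed s (x i)),
        T s * r - diagCoeff (3 : ℤ) (G.out s (x i)) (G.dashed s (x i)) • r,
        mul_ne_zero hc (offCoeff_ne_zero _ _), ?_⟩
      change G.op 3 s (r.1 (single (x 0) 1)) -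
        diagCoeff (3 : ℤ) (G.out s (x i)) (G.dashed s (x i)) • r.1 (single (x 0) 1) = _
      rw [hr, op_single, smul_single, smul_eq_mul, mul_comm c (diagCoeff _ _ _), hs]
      abel
  choose c r hc hr using hwalk
  let e : Option W → ℕ := fun i => (Fintype.equivFin (Option W) i : ℕ)
  have he : Function.Injective e := Fin.val_injective.comp (Equiv.injective _)
  have hdet : ∀ k : ℕ, ((2 ^ k : ℕ) : ℤ) ∣ ∏ i, c (e i) := by
    intro k
    choose a r' hr' using fun i => exists_span_mod_two_pow hn k (r (e i))
    rw [← Matrix.det_diagonal]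
    -- the product is padded by a zero column and a zero row, indexed by `none`
    refine dvd_det_of_eq_mul_add
      (A := fun i j => j.elim 0 (a i))
      (N := fun j l => j.elim 0 fun w => (n w).1 (single (x 0) 1) (x (e l)))
      (Y := fun i l => (r' i).1 (single (x 0) 1) (x (e l))) ?_
      (Matrix.det_eq_zero_of_column_eq_zero none fun _ => rfl)
    intro i l
    have h1 := congrArg (fun f => f (x (e l))) (hr (e i))
    rw [hr' i] at h1
    have h2 : Matrix.diagonal (fun i => c (e i)) i l = single (x (e i)) (c (e i)) (x (e l)) := by
      by_cases hil : i = l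
      · subst hil; simp
      · rw [Matrix.diagonal_apply_ne _ hil, single_eq_of_ne fun h => hil (he (hinj h)).symm]
    rw [h2, ← h1]
    simp only [Subring.coe_add, AddSubmonoidClass.coe_finsetSum, AddSubgroupClass.coe_zsmul,
      LinearMap.add_apply, LinearMap.sum_apply, LinearMap.smul_apply, Finsupp.add_apply,
      Finsupp.finsetSum_apply, Finsupp.smul_apply, Fintype.sum_option,
      Option.elim, smul_eq_mul, mul_zero, zero_add]
    push_cast
    rfl
  have hne : ∏ i, c (e i) ≠ 0 := Finset.prod_ne_zero_iff.2 fun i _ => hc _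
  have := Int.natAbs_dvd_natAbs.2 (hdet (∏ i, c (e i)).natAbs)
  rw [Int.natAbs_natCast] at this
  exact absurd (Nat.le_of_dvd (Int.natAbs_pos.2 hne) this) (not_le.2 Nat.lt_two_pow_self)

/-! ### The height covering -/

variable (G) in
/-- The covering of `G` with vertex set `V × ℤ`, in which the second coordinate is a height. -/
def cover : EdgeSystem S (V × ℤ) where
  nb s x := (G.nb s x.1,
    if G.out s x.1 = true then x.2 + wt (G.dashed s x.1) else x.2 - wt (G.dashed s x.1))
  out s x := G.out s x.1
  dashed s x := G.dashed s x.1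
  nb_nb s x := by
    refine Prod.ext (G.nb_nb s x.1) ?_
    cases ho : G.out s x.1 <;> simp [G.out_nb, G.dashed_nb, ho]
  out_nb s x := G.out_nb s x.1
  dashed_nb s x := G.dashed_nb s x.1

/-- A height defined on a part of `G` gives a section of the covering over this part; on vertices
outside of this part the map below is zero. Sections intertwine the operators. -/
lemma IsHeight.section_comm {s : S} {N : Set V} [DecidablePred (· ∈ N)] {h : V → ℤ}
    (hh : G.IsHeight s N h) (k : ℤ) (f : V →₀ ℤ) :
    Finsupp.linearCombination ℤ (fun x => if x ∈ N then single (x, k + h x) (1 : ℤ) else 0)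
        (G.op 3 s f) =
      G.cover.op 3 s (Finsupp.linearCombination ℤ
        (fun x => if x ∈ N then single (x, k + h x) (1 : ℤ) else 0) f) := by
  induction f using Finsupp.induction_linear with
  | zero => simp
  | add f f' hf hf' => simp only [map_add, hf, hf']
  | single x c =>
    simp only [op_single, map_add, linearCombination_single]
    by_cases hx : x ∈ N
    · have hn := hh.nb_mem x hx
      have hnb : G.cover.nb s (x, k + h x) = (G.nb s x, k + h (G.nb s x)) := by
        refine Prod.ext rfl ?_
        cases ho : G.out s x
        · have := hh.rise _ hn (by rw [G.out_nb, ho]; rfl)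
          rw [G.nb_nb, G.dashed_nb] at this
          simp only [cover, ho, Bool.false_eq_true, if_false]
          omega
        · have := hh.rise _ hx ho
          simp only [cover, ho, if_true]
          omega
      simp only [if_pos hx, if_pos hn, smul_single, smul_eq_mul, mul_one, op_single, hnb]
      rfl
    · have hn : G.nb s x ∉ N := fun h' => hx (by simpa [G.nb_nb] using hh.nb_mem _ h')
      simp [hx, hn]

lemma Braided.cover (hM : ∀ s t, M s t ≠ 0) (hG : G.Braided M (3 : ℤ)) :
    G.cover.Braided M (3 : ℤ) := by
  classical
  intro s t hst
  refine Finsupp.lhom_ext fun ⟨α, i⟩ c => ?_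
  obtain ⟨N, h, hα, hs, ht⟩ := hG.exists_isHeight hM s t α hst
  have e : single (α, i) c = Finsupp.linearCombination ℤ
      (fun x => if x ∈ N then single (x, i - h α + h x) (1 : ℤ) else 0) (single α c) := by
    simp [hα]
  rw [e, ← altProd_intertwine _ _ (hs.section_comm _) (ht.section_comm _),
    ← altProd_intertwine _ _ (ht.section_comm _) (hs.section_comm _), hG s t hst]

/-- If `W` is finite, there is no infinite descending walk: it lifts to the covering, where it
passes through infinitely many vertices. -/
lemma Braided.not_descending (hM : ∀ s t, M s t ≠ 0) [Finite W] (cs : CoxeterSystem M W)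
    (hG : G.Braided M (3 : ℤ)) {x : ℕ → V} : ¬ ∀ i, ∃ w, G.Edge w (x (i + 1)) (x i) := by
  intro hx
  choose w hw using hx
  let y : ℕ → V × ℤ := fun i => (x i, -∑ j ∈ Finset.range i, (w j : ℤ))
  refine (hG.cover hM).not_injective_walk cs (x := y) (fun i => ?_) ?_
  · obtain ⟨s, h1, h2, h3⟩ := hw i
    refine ⟨s, ?_⟩
    have ho : G.out s (x i) = false := by rw [← h2, G.out_nb, h1]; rfl
    have hd : G.dashed s (x i) = G.dashed s (x (i + 1)) := by rw [← h2, G.dashed_nb]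
    refine Prod.ext ?_ ?_
    · simp only [EdgeSystem.cover, y]
      rw [← h2, G.nb_nb]
    · simp only [EdgeSystem.cover, y, ho, hd, h3, Finset.sum_range_succ, Bool.false_eq_true,
        if_false]
      ring
  · have hanti : StrictAnti fun i => (y i).2 := strictAnti_nat_of_succ_lt fun i => by
      have := (hw i).pos
      simp only [y, Finset.sum_range_succ]
      omega
    exact fun i j hij => hanti.injective (congrArg Prod.snd hij)

lemma Braided.not_ascending (hM : ∀ s t, M s t ≠ 0) [Finite W] (cs : CoxeterSystem M W)
    (hG : G.Braided M (3 : ℤ)) {x : ℕ → V} : ¬ ∀ i, ∃ w, G.Edge w (x i) (x (i + 1)) := by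
  intro hx
  choose w hw using hx
  let y : ℕ → V × ℤ := fun i => (x i, ∑ j ∈ Finset.range i, (w j : ℤ))
  refine (hG.cover hM).not_injective_walk cs (x := y) (fun i => ?_) ?_
  · obtain ⟨s, h1, h2, h3⟩ := hw i
    refine ⟨s, Prod.ext h2 ?_⟩
    simp only [EdgeSystem.cover, y, h1, h3, Finset.sum_range_succ, if_true]
  · have hmono : StrictMono fun i => (y i).2 := strictMono_nat_of_lt_succ fun i => by
      have := (hw i).pos
      simp only [y, Finset.sum_range_succ]
      omega
    exact fun i j hij => hmono.injective (congrArg Prod.snd hij)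

end EdgeSystem

/-! ### Sources and sinks -/

/-- If every point has a successor under `r`, then there is an infinite `r`-sequence. -/
lemma exists_seq_of_forall_exists {V : Type*} [Nonempty V] {r : V → V → Prop}
    (h : ∀ x, ∃ y, r x y) : ∃ x : ℕ → V, ∀ i, r (x i) (x (i + 1)) := by
  choose f hf using h
  refine ⟨fun i => f^[i] (Classical.arbitrary V), fun i => ?_⟩
  change r _ (f^[i + 1] _)
  rw [Function.iterate_succ_apply']
  exact hf _

namespace LabeledDigraph

variable {S V : Type*} {Γ : LabeledDigraph S V}

lemma dirAdj_iff_edge {α β : V} : Γ.DirAdj α β ↔ ∃ w, Γ.edgeSystem.Edge w α β := by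
  rw [dirAdj_iff]
  constructor
  · rintro ⟨s, h1, h2⟩
    exact ⟨_, s, h1, h2, rfl⟩
  · rintro ⟨w, s, h1, h2, -⟩
    exact ⟨s, h1, h2⟩

lemma IsConnected.reflTransGen (h : Γ.IsConnected) (x y : V) :
    Relation.ReflTransGen (fun a b => Γ.DirAdj a b ∨ Γ.DirAdj b a) x y :=
  (SimpleGraph.reachable_iff_reflTransGen x y).1 (h.preconnected x y)

end LabeledDigraph

end

theorem theorem3 {S W V : Type*} [Group W] {M : CoxeterMatrix S} (cs : CoxeterSystem M W)
    (hfin : ∀ s t : S, M s t ≠ 0)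
    (Γ : LabeledDigraph S V) (hΓ : Γ.IsWDigraph M) (hconn : Γ.IsConnected) :
    ((∀ σ σ' : V, Γ.IsSource σ → Γ.IsSource σ' → σ = σ') ∧
      (∀ σ σ' : V, Γ.IsSink σ → Γ.IsSink σ' → σ = σ')) ∧
    (((∃ σ : V, Γ.IsSource σ) ∨ (∃ σ : V, Γ.IsSink σ)) → Γ.IsAcyclic) ∧
    (Finite W →
      (∃ σ : V, Γ.IsSource σ) ∧ (∃ σ : V, Γ.IsSink σ) ∧ Γ.IsAcyclic) := by
  have hG := hΓ.braided hfin
  have hD := hG.diamond hfin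
  have hD' := hG.diamond_rev hfin
  have hpos : ∀ w x y, Γ.edgeSystem.Edge w x y → 0 < w := fun _ _ _ h => h.pos
  have hpos' : ∀ w x y, Γ.edgeSystem.rev.Edge w x y → 0 < w := fun _ _ _ h => h.pos
  have hadj : Γ.DirAdj = fun x y => ∃ w, Γ.edgeSystem.Edge w x y :=
    funext₂ fun _ _ => propext LabeledDigraph.dirAdj_iff_edge
  have hadj' : Function.swap Γ.DirAdj = fun x y => ∃ w, Γ.edgeSystem.rev.Edge w x y := by
    simp only [EdgeSystem.rev_edge]
    exact funext₂ fun _ _ => propext LabeledDigraph.dirAdj_iff_edge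
  have hc : ∀ x y, Relation.ReflTransGen (fun a b => (∃ w, Γ.edgeSystem.Edge w a b) ∨
      ∃ w, Γ.edgeSystem.Edge w b a) x y := by
    simpa only [LabeledDigraph.dirAdj_iff_edge] using hconn.reflTransGen
  have hc' : ∀ x y, Relation.ReflTransGen (fun a b => (∃ w, Γ.edgeSystem.rev.Edge w a b) ∨
      ∃ w, Γ.edgeSystem.rev.Edge w b a) x y := by
    simpa only [EdgeSystem.rev_edge, or_comm] using hc
  have hsrc : ∀ σ, Γ.IsSource σ → ∀ w x, ¬ Γ.edgeSystem.Edge w x σ :=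
    fun σ h w x hw => h x (LabeledDigraph.dirAdj_iff_edge.2 ⟨w, hw⟩)
  have hsink : ∀ σ, Γ.IsSink σ → ∀ w x, ¬ Γ.edgeSystem.rev.Edge w x σ :=
    fun σ h w x hw => h x (LabeledDigraph.dirAdj_iff_edge.2 ⟨w, EdgeSystem.rev_edge.1 hw⟩)
  have hacyc : ((∃ σ : V, Γ.IsSource σ) ∨ (∃ σ : V, Γ.IsSink σ)) → Γ.IsAcyclic := by
    rintro (⟨σ, hσ⟩ | ⟨σ, hσ⟩) α hα
    · rw [hadj] at hα
      exact WPath.acyclic_of_source hD hpos (hsrc σ hσ) hc α hα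
    · rw [← Relation.transGen_swap, hadj'] at hα
      exact WPath.acyclic_of_source hD' hpos' (hsink σ hσ) hc' α hα
  refine ⟨⟨fun σ σ' h h' => WPath.source_unique hD hpos (hsrc σ h) (hsrc σ' h') hc,
    fun σ σ' h h' => WPath.source_unique hD' hpos' (hsink σ h) (hsink σ' h') hc'⟩, hacyc, ?_⟩
  intro hW
  have : Nonempty V := hconn.nonempty
  have h1 : ∃ σ, Γ.IsSource σ := by
    by_contra hno
    simp only [LabeledDigraph.IsSource, not_exists, not_forall, not_not,
      LabeledDigraph.dirAdj_iff_edge] at hno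
    obtain ⟨x, hx⟩ := exists_seq_of_forall_exists hno
    exact hG.not_descending hfin cs hx
  have h2 : ∃ σ, Γ.IsSink σ := by
    by_contra hno
    simp only [LabeledDigraph.IsSink, not_exists, not_forall, not_not,
      LabeledDigraph.dirAdj_iff_edge] at hno
    obtain ⟨x, hx⟩ := exists_seq_of_forall_exists hno
    exact hG.not_ascending hfin cs hx
  exact ⟨h1, h2, hacyc (Or.inl h1)⟩
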